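/- All graphs are finite, simple and nonnull (at least one vertex); $\omega(G)$ and $\chi(G)$ denote the clique number and the chromatic number of $G$, $\mathbb{N}$ is the set of positive integers, and $N_G[v]$ is the closed neighborhood of $v$ in $G$. For an integer $k \ge 4$, a *$k$-ring* is a graph $R$ whose vertex set can be partitioned into nonempty sets $X_1,\dots,X_k$ (indices modulo $k$) such that each $X_i$ can be ordered as $X_i=\{u_i^1,\dots,u_i^{|X_i|}\}$ with $$X_i \subseteq N_R[u_i^{|X_i|}] \subseteq \dots \subseteq N_R[u_i^1] = X_{i-1}\cup X_i\cup X_{i+1}.$$ A vertex is *simplicial* if its neighborhood is a (possibly empty) clique. Let $\mathcal{R}_k$ be the class of all graphs $G$ such that every induced subgraph of $G$ either is a $k$-ring or has a simplicial vertex. A class of graphs is *hereditary* if it contains all isomorphic copies of induced subgraphs of its members. A hereditary class $\mathcal{G}$ is *$\chi$-bounded* if there is a function $f:\mathbb{N}\to\mathbb{N}$, called a *$\chi$-bounding function* for $\mathcal{G}$, such that $\chi(G)\le f(\omega(G))$ for all $G\in\mathcal{G}$. For a hereditary $\chi$-bounded class $\mathcal{G}$ that contains all complete graphs, a $\chi$-bounding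 function $f$ for $\mathcal{G}$ is *optimal* if for every $n\in\mathbb{N}$ there is a graph $G\in\mathcal{G}$ with $\omega(G)=n$ and $\chi(G)=f(n)$. For odd $k\ge 5$ and $n\in\mathbb{N}$, let $f_k(n)=\left\lfloor \frac{kn}{k-1}\right\rfloor$ if $n\equiv 0$ or $1 \pmod{k-1}$, and $f_k(n)=\left\lceil \frac{kn}{k-1}\right\rceil$ otherwise. **Theorem.** Let $k\ge 4$ be an integer. Then $\mathcal{R}_k$ is (hereditary, contains all complete graphs, and is) $\chi$-bounded. Furthermore, if $k$ is even, then the identity function on $\mathbb{N}$ is the optimal $\chi$-bounding function for $\mathcal{R}_k$, and if $k$ is odd, then $f_k$ is the optimal $\chi$-bounding function for $\mathcal{R}_k$; moreover, for odd $k$, $f_k(n)=n+\left\lceil \frac{2\lfloor n/2\rfloor}{k-1}\right\rceil$ for all $n\in\mathbb{N}$. -/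

import Mathlib

universe u

/-- A graph: finite, simple and nonnull. -/
structure FinGraph where
  /-- the vertices -/
  V : Type u
  /-- the adjacency structure -/
  graph : SimpleGraph V
  finite : Finite V
  nonempty : Nonempty V

attribute [instance] FinGraph.finite FinGraph.nonempty

namespace FinGraph

/-- The closed neighborhood `N[v]`. -/
def closedNbhd {V : Type*} (G : SimpleGraph V) (v : V) : Set V :=
  insert v (G.neighborSet v)

/-- A simplicial vertex: its neighborhood is a (possibly empty) clique. -/
def IsSimplicial {V : Type*} (G : SimpleGraph V) (v : V) : Prop :=
  G.IsClique (G.neighborSet v)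

/-- `(X_i)`, with indices modulo `k`, is a ring partition of `G`: the `X_i` are nonempty, pairwise
disjoint, cover the vertex set, and each `X_i` can be listed without repetition as
`u 0, …, u m` so that `X_i ⊆ N[u m] ⊆ … ⊆ N[u 0] = X_{i-1} ∪ X_i ∪ X_{i+1}`. -/
structure IsRingPartition {V : Type*} (G : SimpleGraph V) (k : ℕ) (X : ZMod k → Set V) :
    Prop where
  nonempty : ∀ i, (X i).Nonempty
  disjoint : ∀ i j, i ≠ j → Disjoint (X i) (X j)
  cover : ⋃ i, X i = Set.univ
  ordered : ∀ i, ∃ (m : ℕ) (u : Fin (m + 1) → V),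
    Function.Injective u ∧ Set.range u = X i ∧
    X i ⊆ closedNbhd G (u (Fin.last m)) ∧
    (∀ a b : Fin (m + 1), a ≤ b → closedNbhd G (u b) ⊆ closedNbhd G (u a)) ∧
    closedNbhd G (u 0) = X (i - 1) ∪ X i ∪ X (i + 1)

/-- `G` is a `k`-ring, i.e. a ring of length `k` (where `k ≥ 4`). -/
def IsRing {V : Type*} (G : SimpleGraph V) (k : ℕ) : Prop :=
  4 ≤ k ∧ ∃ X : ZMod k → Set V, IsRingPartition G k X

/-- The class `R_k`: every induced subgraph (on a nonempty set of vertices) either is a `k`-ring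
or has a simplicial vertex. -/
def ringClass (k : ℕ) : Set FinGraph.{u} :=
  {G | ∀ S : Set G.V, S.Nonempty →
    IsRing (G.graph.induce S) k ∨ ∃ v : S, IsSimplicial (G.graph.induce S) v}

/-- A class of graphs is hereditary if it contains all isomorphic copies of induced subgraphs of
its members. -/
def Hereditary (C : Set FinGraph.{u}) : Prop :=
  ∀ G ∈ C, ∀ H : FinGraph.{u}, Nonempty (H.graph ↪g G.graph) → H ∈ C

/-- The class contains all complete graphs. -/
def ContainsComplete (C : Set FinGraph.{u}) : Prop :=
  ∀ G : FinGraph.{u}, G.graph = ⊤ → G ∈ C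

/-- `f` is a `χ`-bounding function for `C`: `χ(G) ≤ f(ω(G))` for all `G ∈ C`. As graphs are nonnull,
the value `f 0` plays no role. -/
def IsChiBounding (C : Set FinGraph.{u}) (f : ℕ → ℕ) : Prop :=
  ∀ G ∈ C, G.graph.chromaticNumber ≤ (f G.graph.cliqueNum : ℕ∞)

/-- A `χ`-bounded class: a hereditary class that has a `χ`-bounding function. -/
def ChiBounded (C : Set FinGraph.{u}) : Prop :=
  Hereditary C ∧ ∃ f : ℕ → ℕ, IsChiBounding C f

/-- `f` is the optimal `χ`-bounding function for `C`, a hereditary `χ`-bounded class that contains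
all complete graphs: `f` is a `χ`-bounding function, and every positive integer `n` is the clique
number of a member of `C` with chromatic number `f n`. -/
structure IsOptimalChiBounding (C : Set FinGraph.{u}) (f : ℕ → ℕ) : Prop where
  chiBounded : ChiBounded C
  containsComplete : ContainsComplete C
  bounding : IsChiBounding C f
  attained : ∀ n : ℕ, 1 ≤ n →
    ∃ G ∈ C, G.graph.cliqueNum = n ∧ G.graph.chromaticNumber = (f n : ℕ∞)

/-- The function `f_k` (used for odd `k ≥ 5`): `⌊kn/(k-1)⌋` if `n ≡ 0, 1 (mod k-1)`, and
`⌈kn/(k-1)⌉` otherwise. -/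
def ringBound (k n : ℕ) : ℕ :=
  if n % (k - 1) = 0 ∨ n % (k - 1) = 1 then
    ⌊(k : ℚ) * (n : ℚ) / ((k : ℚ) - 1)⌋₊
  else
    ⌈(k : ℚ) * (n : ℚ) / ((k : ℚ) - 1)⌉₊

end FinGraph

namespace FinGraph
open SimpleGraph

/-! ### Colouring rings -/

section Rings

variable {V : Type*} {G : SimpleGraph V} {k : ℕ} {X : ZMod k → Set V}

/-! Upper bound. Colour greedily along simplicial vertices: such a vertex has at most `ω - 1`
neighbours, so only induced `k`-rings need a real colouring (`colorable_of_simplicial_or`). In a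
ring the nested neighbourhoods turn an edge between consecutive bags into a clique of all
lower-ranked vertices, so the two ranks sum to at most `n` (`exists_coordinates`). It then suffices
to colour pairs (bag, rank) injectively in each bag, so that equal colours in consecutive bags have
rank sum above `n` (`colorable_of_coordinates`).

For even `k`, alternate the rank order with its reversal. For odd `k` this alternation does not
close up around the cycle; `t` extra colours, with `⌊n/2⌋ ≤ m * t` and `k = 2 * m + 1`, let the
order be reversed gradually, on a growing interval of colours (`colorable_of_odd`).

Lower bound. Complete graphs suffice for even `k`. For odd `k`, take a clique blow-up of the
`k`-cycle with `n * m + ⌊n/2⌋` vertices and clique number `n`. Its stable sets have at most `m`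
vertices, so at least `n + ⌈⌊n/2⌋ / m⌉` colours are needed; `ringBound_eq` identifies this number
with `f_k`. -/

theorem mem_closedNbhd {v w : V} : w ∈ closedNbhd G v ↔ w = v ∨ G.Adj v w := by
  simp [closedNbhd]

theorem mem_closedNbhd_comm {v w : V} : w ∈ closedNbhd G v ↔ v ∈ closedNbhd G w := by
  rw [mem_closedNbhd, mem_closedNbhd, eq_comm, G.adj_comm]

/-- A ring whose cliques have at most `n` vertices has coordinates `(β v, ρ v)`, the bag of `v` and
the rank of `v` in its bag, such that adjacent vertices lie in equal or consecutive bags, and the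
ranks of adjacent vertices in consecutive bags add up to at most `n`. -/
theorem IsRingPartition.exists_coordinates (hk : 2 ≤ k) (hX : IsRingPartition G k X) {n : ℕ}
    (hn : G.CliqueFree (n + 1)) :
    ∃ (β : V → ZMod k) (ρ : V → ℕ), (∀ v w, β v = β w → ρ v = ρ w → v = w) ∧
      (∀ v, 1 ≤ ρ v ∧ ρ v ≤ n) ∧
      (∀ v w, G.Adj v w → β w = β v ∨ β w = β v + 1 ∨ β v = β w + 1) ∧
      ∀ v w, G.Adj v w → β w = β v + 1 → ρ v + ρ w ≤ n := by
  classical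
  have hone : ∀ i : ZMod k, i ≠ i + 1 := by
    intro i h
    have : Fact (1 < k) := ⟨hk⟩
    exact one_ne_zero (left_eq_add.mp h)
  choose m u hinj hrange hlast hmono hzero using hX.ordered
  have hmem : ∀ v : V, ∃ i, ∃ a : Fin (m i + 1), u i a = v := by
    intro v
    have : v ∈ ⋃ i, X i := hX.cover ▸ Set.mem_univ v
    obtain ⟨i, hi⟩ := Set.mem_iUnion.mp this
    rw [← hrange i] at hi
    exact ⟨i, hi⟩
  choose β a ha using hmem
  have huX : ∀ i c, u i c ∈ X i := fun i c => hrange i ▸ Set.mem_range_self c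
  have hβ : ∀ v, v ∈ X (β v) := fun v => by
    have := huX (β v) (a v); rwa [ha] at this
  have huniq : ∀ v i, v ∈ X i → β v = i := by
    intro v i hv
    by_contra hne
    exact Set.disjoint_left.mp (hX.disjoint _ _ hne) (hβ v) hv
  have hsame : ∀ i c d, u i c ∈ closedNbhd G (u i d) := fun i c d =>
    hmono i d _ (Fin.le_last d) (hlast i (huX i c))
  have hclique : ∀ s : Finset V, G.IsClique s → s.card ≤ n := by
    intro s hs
    by_contra hlt
    obtain ⟨t, hts, ht⟩ := Finset.exists_subset_card_eq (show n + 1 ≤ s.card by omega)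
    exact hn t ⟨hs.subset (by exact_mod_cast hts), ht⟩
  -- Closed neighbourhoods shrink as the rank grows, so either end of an edge may be replaced by a
  -- vertex of lower rank in its bag.
  have hcross : ∀ v w, G.Adj v w → ∀ c ≤ a v, ∀ d ≤ a w,
      u (β w) d ∈ closedNbhd G (u (β v) c) := by
    intro v w hvw c hc d hd
    have h1 : w ∈ closedNbhd G (u (β v) c) := by
      apply hmono _ _ _ hc
      rw [ha, mem_closedNbhd]
      exact Or.inr hvw
    rw [mem_closedNbhd_comm] at h1 ⊢
    apply hmono _ _ _ hd
    rwa [ha]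
  have hcard : ∀ i (c : Fin (m i + 1)), ((Finset.Iic c).image (u i)).card = c + 1 := by
    intro i c
    rw [Finset.card_image_of_injective _ (hinj i), Fin.card_Iic]
  have hbag : ∀ i (c : Fin (m i + 1)), G.IsClique ((Finset.Iic c).image (u i) : Finset V) := by
    intro i c x hx y hy hxy
    simp only [Finset.coe_image, Set.mem_image] at hx hy
    obtain ⟨c, -, rfl⟩ := hx
    obtain ⟨d, -, rfl⟩ := hy
    exact (mem_closedNbhd.mp (hsame i d c)).resolve_left (Ne.symm hxy)
  refine ⟨β, fun v => a v + 1, ?_, ?_, ?_, ?_⟩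
  · intro v w h1 h2
    have key : ∀ i j (c : Fin (m i + 1)) (d : Fin (m j + 1)), i = j → (c : ℕ) + 1 = d + 1 →
        u i c = u j d := by
      rintro i _ c d rfl h
      congr 1
      ext
      omega
    rw [← ha v, ← ha w]
    exact key _ _ _ _ h1 h2
  · intro v
    refine ⟨Nat.le_add_left _ _, ?_⟩
    have := hclique _ (hbag (β v) (a v))
    rwa [hcard] at this
  · intro v w hvw
    have h1 : w ∈ closedNbhd G (u (β v) 0) := by
      apply hmono _ _ (a v) (Fin.zero_le _)
      rw [ha, mem_closedNbhd]
      exact Or.inr hvw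
    rw [hzero] at h1
    rcases h1 with (h | h) | h
    · right; right
      rw [huniq _ _ h]; ring
    · exact Or.inl (huniq _ _ h)
    · exact Or.inr (Or.inl (huniq _ _ h))
  · intro v w hvw hb
    have hdisj : Disjoint ((Finset.Iic (a v)).image (u (β v)))
        ((Finset.Iic (a w)).image (u (β w))) := by
      rw [Finset.disjoint_left]
      intro x hx hy
      simp only [Finset.mem_image] at hx hy
      obtain ⟨c, -, rfl⟩ := hx
      obtain ⟨d, -, hd⟩ := hy
      have h1 := huniq _ _ (huX (β v) c)
      have h2 := huniq _ _ (hd ▸ huX (β w) d)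
      exact hone (β v) (by rw [← hb, ← h2, h1])
    have hc : G.IsClique (((Finset.Iic (a v)).image (u (β v)) ∪
        (Finset.Iic (a w)).image (u (β w)) : Finset V) : Set V) := by
      intro x hx y hy hxy
      rw [Finset.mem_coe, Finset.mem_union] at hx hy
      rcases hx with hx | hx <;> rcases hy with hy | hy
      · exact hbag _ _ hx hy hxy
      · simp only [Finset.mem_image, Finset.mem_Iic] at hx hy
        obtain ⟨c, hc, rfl⟩ := hx
        obtain ⟨d, hd, rfl⟩ := hy
        exact (mem_closedNbhd.mp (hcross v w hvw c hc d hd)).resolve_left (Ne.symm hxy)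
      · simp only [Finset.mem_image, Finset.mem_Iic] at hx hy
        obtain ⟨d, hd, rfl⟩ := hx
        obtain ⟨c, hc, rfl⟩ := hy
        exact ((mem_closedNbhd.mp (hcross v w hvw c hc d hd)).resolve_left hxy).symm
      · exact hbag _ _ hx hy hxy
    have := hclique _ hc
    rw [Finset.card_union_of_disjoint hdisj, hcard, hcard] at this
    omega

/-- A colouring of all coordinates `(i, a)` with `i < k` and `1 ≤ a ≤ n` gives a colouring of every
`k`-ring whose cliques have at most `n` vertices. -/
theorem IsRing.colorable_of_coordinates (hG : IsRing G k) {n : ℕ} (hn : G.CliqueFree (n + 1))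
    {c : ℕ} (col : ℕ → ℤ → ℤ)
    (hrange : ∀ i (a : ℤ), 1 ≤ a → a ≤ n → 1 ≤ col i a ∧ col i a ≤ c)
    (hinj : ∀ i (a b : ℤ), 1 ≤ a → a ≤ n → 1 ≤ b → b ≤ n → col i a = col i b → a = b)
    (hstep : ∀ i (a b : ℤ), 1 ≤ a → a ≤ n → 1 ≤ b → b ≤ n → col i a = col (i + 1) b → n < a + b)
    (hcyc : ∀ a : ℤ, 1 ≤ a → a ≤ n → col k a = col 0 a) : G.Colorable c := by
  obtain ⟨hk, X, hX⟩ := hG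
  have : NeZero k := ⟨by omega⟩
  have : Fact (1 < k) := ⟨by omega⟩
  obtain ⟨β, ρ, hcoord, hρ, hadj, hsum⟩ := hX.exists_coordinates (by omega) hn
  have hρ1 : ∀ v, (1 : ℤ) ≤ ρ v := fun v => by exact_mod_cast (hρ v).1
  have hρ2 : ∀ v, (ρ v : ℤ) ≤ n := fun v => by exact_mod_cast (hρ v).2
  have hnext : ∀ v w, G.Adj v w → β w = β v + 1 →
      col (β v).val (ρ v) ≠ col (β w).val (ρ w) := by
    intro v w hvw hb heq
    have hs := hsum v w hvw hb
    have hlt : (n : ℤ) < ρ v + ρ w := by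
      apply hstep (β v).val _ _ (hρ1 v) (hρ2 v) (hρ1 w) (hρ2 w)
      rw [heq, hb, ZMod.val_add, ZMod.val_one]
      -- After bag `k - 1` the colouring continues at index `k` while the ring returns to bag `0`;
      -- `hcyc` identifies the two.
      rcases Nat.lt_or_ge ((β v).val + 1) k with h | h
      · rw [Nat.mod_eq_of_lt h]
      · have : (β v).val + 1 = k := le_antisymm (ZMod.val_lt _) h
        rw [this, Nat.mod_self, hcyc _ (hρ1 w) (hρ2 w)]
    omega
  have hproper : ∀ v w, G.Adj v w → col (β v).val (ρ v) ≠ col (β w).val (ρ w) := by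
    intro v w hvw heq
    rcases hadj v w hvw with h | h | h
    · rw [h] at heq
      have := hinj _ _ _ (hρ1 v) (hρ2 v) (hρ1 w) (hρ2 w) heq
      exact hvw.ne (hcoord v w h.symm (by exact_mod_cast this))
    · exact hnext v w hvw h heq
    · exact hnext w v hvw.symm h heq.symm
  rw [SimpleGraph.colorable_iff_exists_bdd_nat_coloring]
  refine ⟨SimpleGraph.Coloring.mk (fun v => (col (β v).val (ρ v) - 1).toNat) ?_, ?_⟩
  · intro v w hvw heq
    have h1 := hrange (β v).val _ (hρ1 v) (hρ2 v)
    have h2 := hrange (β w).val _ (hρ1 w) (hρ2 w)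
    exact hproper v w hvw (by omega)
  · intro v
    have h1 := hrange (β v).val _ (hρ1 v) (hρ2 v)
    change (col (β v).val (ρ v) - 1).toNat < c
    omega

/-- With alternating orders, a colour shared by consecutive bags has ranks `a` and `n + 1 - a`,
whose sum exceeds `n`. -/
theorem IsRing.colorable_of_even (hG : IsRing G k) (hk : Even k) {n : ℕ}
    (hn : G.CliqueFree (n + 1)) : G.Colorable n := by
  refine hG.colorable_of_coordinates hn (fun i a => if i % 2 = 0 then a else n + 1 - a)
    ?_ ?_ ?_ ?_
  · intro i a h1 h2
    split_ifs <;> omega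
  · intro i a b _ _ _ _ h
    split_ifs at h <;> omega
  · intro i a b _ _ _ _ h
    split_ifs at h <;> omega
  · intro a _ _
    simp [Nat.even_iff.mp hk]

/-! ### Rings of odd length: gradual reversal -/

/-- The involution of `ℤ` that reverses the interval `[l, r]`. -/
def reverseInterval (l r x : ℤ) : ℤ :=
  if l ≤ x ∧ x ≤ r then l + r - x else x

theorem reverseInterval_involutive (l r x : ℤ) :
    reverseInterval l r (reverseInterval l r x) = x := by
  unfold reverseInterval
  split_ifs <;> omega

theorem reverseInterval_mem {l r c x : ℤ} (hl : 1 ≤ l) (hr : r ≤ c) (hx : 1 ≤ x ∧ x ≤ c) :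
    1 ≤ reverseInterval l r x ∧ reverseInterval l r x ≤ c := by
  unfold reverseInterval
  split_ifs <;> omega

/-- On `[l, r]` the value rises by `r' - r`; a newly covered `x > r` goes to `l + r' - x < l + t`,
which is below `x + t`. -/
theorem reverseInterval_le_of_right {l r r' t : ℤ} (_ : l ≤ r) (h : r ≤ r') (h' : r' ≤ r + t)
    (x : ℤ) : reverseInterval l r' x ≤ reverseInterval l r x + t := by
  unfold reverseInterval
  split_ifs <;> omega

theorem le_reverseInterval_of_left {l l' r t : ℤ} (_ : l ≤ r) (h : l' ≤ l) (h' : l - t ≤ l')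
    (x : ℤ) : reverseInterval l r x - t ≤ reverseInterval l' r x := by
  unfold reverseInterval
  split_ifs <;> omega

/-- Plain alternation on `c = n + t` colours makes shared colours have rank sum `c + 1`, a surplus
of `t` over the required `n + 1`. This slack pays for enlarging the reversed interval by `t` at one
end per step. -/
theorem IsRing.colorable_of_odd {m : ℕ} (hG : IsRing G (2 * m + 1)) {n t : ℕ} (hn1 : 1 ≤ n)
    (hn : G.CliqueFree (n + 1)) (ht : n / 2 ≤ m * t) : G.Colorable (n + t) := by
  let c : ℤ := n + t
  let h : ℤ := n / 2
  -- The interval starts as the single point `h + 1`. Its right end moves at even steps (`m + 1`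
  -- times) and its left end at odd steps (`m` times), enough to reach all of `[1, c]` at index `2 *
  -- m + 1`.
  let l : ℕ → ℤ := fun i => max 1 (h + 1 - t * (i / 2 : ℕ))
  let r : ℕ → ℤ := fun i => min c (h + 1 + t * ((i + 1) / 2 : ℕ))
  have ht' : h ≤ m * t := by simp only [h]; exact_mod_cast ht
  have hmul : ∀ j : ℕ, (0 : ℤ) ≤ t * j := fun j => by positivity
  have hl1 : ∀ i, 1 ≤ l i := fun i => le_max_left _ _
  have hrc : ∀ i, r i ≤ c := fun i => min_le_left _ _
  have hlr : ∀ i, l i ≤ r i := by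
    intro i
    have h1 := hmul (i / 2)
    have h2 := hmul ((i + 1) / 2)
    simp only [l, r, c, h]
    omega
  have hright : ∀ i, i % 2 = 0 → l (i + 1) = l i ∧ r i ≤ r (i + 1) ∧ r (i + 1) ≤ r i + t := by
    intro i hi
    have e1 : (i + 1) / 2 = i / 2 := by omega
    have e2 : (i + 1 + 1) / 2 = i / 2 + 1 := by omega
    simp only [l, r, e1, e2]
    rw [Nat.cast_succ, mul_add, mul_one]
    generalize (t : ℤ) * (i / 2 : ℕ) = z
    refine ⟨trivial, ?_, ?_⟩ <;> omega
  have hleft : ∀ i, i % 2 = 1 → r (i + 1) = r i ∧ l (i + 1) ≤ l i ∧ l i - t ≤ l (i + 1) := by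
    intro i hi
    have e1 : (i + 1) / 2 = i / 2 + 1 := by omega
    have e2 : (i + 1 + 1) / 2 = i / 2 + 1 := by omega
    simp only [l, r, e1, e2]
    rw [Nat.cast_succ, mul_add, mul_one]
    generalize (t : ℤ) * (i / 2 : ℕ) = z
    refine ⟨trivial, ?_, ?_⟩ <;> omega
  refine hG.colorable_of_coordinates hn
    (fun i a => reverseInterval (l i) (r i) (if i % 2 = 0 then a else c + 1 - a)) ?_ ?_ ?_ ?_
  · intro i a h1 h2
    have := reverseInterval_mem (hl1 i) (hrc i)
      (show 1 ≤ (if i % 2 = 0 then a else c + 1 - a) ∧ (if i % 2 = 0 then a else c + 1 - a) ≤ c by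
        simp only [c]; split_ifs <;> omega)
    exact_mod_cast this
  · intro i a b _ _ _ _ hab
    have := congrArg (reverseInterval (l i) (r i)) hab
    simp only [reverseInterval_involutive] at this
    split_ifs at this <;> omega
  · intro i a b _ _ _ _ hab
    set x := reverseInterval (l i) (r i) (if i % 2 = 0 then a else c + 1 - a) with hx
    have ha := congrArg (reverseInterval (l i) (r i)) hx
    have hb := congrArg (reverseInterval (l (i + 1)) (r (i + 1))) hab
    simp only [reverseInterval_involutive] at ha hb
    rcases Nat.mod_two_eq_zero_or_one i with hi | hi
    · obtain ⟨e, h1, h2⟩ := hright i hi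
      have := reverseInterval_le_of_right (hlr i) h1 h2 x
      rw [e] at hb
      rw [if_pos hi] at ha
      rw [if_neg (by omega)] at hb
      simp only [c] at hb
      omega
    · obtain ⟨e, h1, h2⟩ := hleft i hi
      have := le_reverseInterval_of_left (hlr i) h1 h2 x
      rw [e] at hb
      rw [if_neg (by omega)] at ha
      rw [if_pos (by omega)] at hb
      simp only [c] at ha
      omega
  · intro a h1 h2
    have e1 : (2 * m + 1) / 2 = m := by omega
    have e2 : (2 * m + 1 + 1) / 2 = m + 1 := by omega
    have e3 : (2 * m + 1) % 2 ≠ 0 := by omega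
    have hmt : (t : ℤ) * (m + 1) = m * t + t := by ring
    have el : l (2 * m + 1) = 1 := by
      simp only [l, e1]
      rw [mul_comm]
      omega
    have er : r (2 * m + 1) = c := by
      simp only [r, e2, c]
      push_cast
      rw [hmt]
      omega
    have el0 : l 0 = h + 1 := by simp only [l, h]; simp; omega
    have er0 : r 0 = h + 1 := by simp only [r, h, c]; simp; omega
    -- At index `k` reversing all of `[1, c]` cancels the reversal from odd parity; at index `0`
    -- reversing one point does nothing. Both give colour `a`.
    rw [el, er, el0, er0, if_neg e3, if_pos rfl]
    simp only [reverseInterval, c]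
    split_ifs <;> omega

end Rings

/-! ### The class of rings -/

/-- Greedy colouring along simplicial vertices. -/
theorem colorable_of_simplicial_or {V : Type*} [Finite V] {G : SimpleGraph V} {n N : ℕ}
    (hn : G.CliqueFree (n + 1)) (hN : n ≤ N)
    (hG : ∀ S : Set V, S.Nonempty → (G.induce S).Colorable N ∨
      ∃ v : S, IsSimplicial (G.induce S) v) : G.Colorable N := by
  classical
  have key : ∀ (j : ℕ) (S : Finset V), S.card = j → ∃ f : V → ℕ, (∀ x ∈ S, f x < N) ∧
      ∀ x ∈ S, ∀ y ∈ S, G.Adj x y → f x ≠ f y := by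
    intro j
    induction j with
    | zero =>
      intro S hS
      rw [Finset.card_eq_zero] at hS
      subst hS
      exact ⟨fun _ => 0, by simp, by simp⟩
    | succ j ih =>
      intro S hS
      have hne : S.Nonempty := Finset.card_pos.mp (by omega)
      rcases hG S hne with h | ⟨⟨v, hv⟩, hs⟩
      · obtain ⟨C⟩ := h
        refine ⟨fun x => if hx : x ∈ S then C ⟨x, hx⟩ else 0, ?_, ?_⟩
        · intro x hx
          simp only [hx, dif_pos]
          exact (C ⟨x, hx⟩).2
        · intro x hx y hy hxy heq
          simp only [hx, hy, dif_pos] at heq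
          exact C.valid (v := ⟨x, hx⟩) (w := ⟨y, hy⟩) hxy (Fin.ext heq)
      · have hv : v ∈ S := hv
        obtain ⟨f, hf1, hf2⟩ := ih (S.erase v) (by rw [Finset.card_erase_of_mem hv]; omega)
        -- As `v` is simplicial, `v` and its neighbours in `S` form a clique, so fewer than `N`
        -- colours are blocked at `v`.
        let T := S.filter (G.Adj v)
        have hvT : v ∉ T := by simp [T]
        have hclique : G.IsClique (insert v T : Finset V) := by
          rw [Finset.coe_insert, SimpleGraph.isClique_insert]
          refine ⟨?_, fun b hb _ => (Finset.mem_filter.mp hb).2⟩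
          intro x hx y hy hxy
          obtain ⟨hx1, hx2⟩ := Finset.mem_filter.mp hx
          obtain ⟨hy1, hy2⟩ := Finset.mem_filter.mp hy
          exact hs (show (⟨x, hx1⟩ : (S : Set V)) ∈ _ from hx2)
            (show (⟨y, hy1⟩ : (S : Set V)) ∈ _ from hy2) (by simpa using hxy)
        have hcard : T.card + 1 ≤ n := by
          rw [← Finset.card_insert_of_notMem hvT]
          by_contra hlt
          obtain ⟨t, hts, ht⟩ := Finset.exists_subset_card_eq
            (show n + 1 ≤ (insert v T).card by omega)
          exact hn t ⟨hclique.subset (by exact_mod_cast hts), ht⟩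
        obtain ⟨c, hc1, hc2⟩ : ∃ c ∈ Finset.range N, c ∉ T.image f := by
          by_contra! hall
          have h1 := Finset.card_le_card (show Finset.range N ⊆ T.image f from hall)
          have h2 := Finset.card_image_le (s := T) (f := f)
          rw [Finset.card_range] at h1
          omega
        have hnew : ∀ y ∈ S, G.Adj v y → f y ≠ c := by
          intro y hy hvy heq
          exact hc2 (Finset.mem_image.mpr ⟨y, Finset.mem_filter.mpr ⟨hy, hvy⟩, heq⟩)
        refine ⟨Function.update f v c, ?_, ?_⟩
        · intro x hx
          rcases eq_or_ne x v with rfl | hxv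
          · simpa using hc1
          · rw [Function.update_of_ne hxv]
            exact hf1 x (Finset.mem_erase.mpr ⟨hxv, hx⟩)
        · intro x hx y hy hxy
          rcases eq_or_ne x v with rfl | hxv
          · rw [Function.update_self, Function.update_of_ne hxy.ne']
            exact (hnew y hy hxy).symm
          · rcases eq_or_ne y v with rfl | hyv
            · rw [Function.update_self, Function.update_of_ne hxy.ne]
              exact hnew x hx hxy.symm
            · rw [Function.update_of_ne hxv, Function.update_of_ne hyv]
              exact hf2 x (Finset.mem_erase.mpr ⟨hxv, hx⟩) y (Finset.mem_erase.mpr ⟨hyv, hy⟩) hxy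
  have := Fintype.ofFinite V
  obtain ⟨f, hf1, hf2⟩ := key _ Finset.univ rfl
  rw [SimpleGraph.colorable_iff_exists_bdd_nat_coloring]
  exact ⟨SimpleGraph.Coloring.mk f fun {v w} h =>
    hf2 v (Finset.mem_univ _) w (Finset.mem_univ _) h, fun v => hf1 v (Finset.mem_univ _)⟩

theorem cliqueFree_cliqueNum_succ {V : Type*} [Finite V] (G : SimpleGraph V) :
    G.CliqueFree (G.cliqueNum + 1) := by
  intro s hs
  have := hs.isClique.card_le_cliqueNum
  rw [hs.card_eq] at this
  omega

theorem one_le_cliqueNum {V : Type*} [Finite V] [Nonempty V] (G : SimpleGraph V) :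
    1 ≤ G.cliqueNum := by
  obtain ⟨v⟩ := ‹Nonempty V›
  have : G.IsClique ({v} : Finset V) := by simp
  simpa using this.card_le_cliqueNum

/-- Rings are coloured from a bound on their cliques, here `ω(G)` for the whole graph, so `f` need
not be monotone. -/
theorem isChiBounding_ringClass {k : ℕ} {f : ℕ → ℕ} (hf : ∀ n, n ≤ f n)
    (hring : ∀ (V : Type u) (G : SimpleGraph V) (n : ℕ), 1 ≤ n → IsRing G k →
      G.CliqueFree (n + 1) → G.Colorable (f n)) :
    IsChiBounding (ringClass.{u} k) f := by
  intro G hG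
  rw [SimpleGraph.chromaticNumber_le_iff_colorable]
  refine colorable_of_simplicial_or (cliqueFree_cliqueNum_succ G.graph) (hf _) fun S hS => ?_
  refine (hG S hS).imp_left fun h => hring _ _ _ (one_le_cliqueNum G.graph) h ?_
  exact (cliqueFree_cliqueNum_succ G.graph).comap ⟨(SimpleGraph.Embedding.induce S).toCopy⟩

/-! ### Transport along isomorphisms; hereditariness and complete graphs -/

section Iso

variable {V W : Type*} {G : SimpleGraph V} {H : SimpleGraph W}

theorem image_closedNbhd (e : G ≃g H) (v : V) :
    e '' closedNbhd G v = closedNbhd H (e v) := by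
  ext w
  obtain ⟨w, rfl⟩ := e.surjective w
  simp [mem_closedNbhd, e.map_adj_iff]

theorem IsSimplicial.map (e : G ≃g H) {v : V} (hv : IsSimplicial G v) :
    IsSimplicial H (e v) := by
  intro x hx y hy hxy
  obtain ⟨x, rfl⟩ := e.surjective x
  obtain ⟨y, rfl⟩ := e.surjective y
  rw [SimpleGraph.mem_neighborSet, e.map_adj_iff] at hx hy
  rw [e.map_adj_iff]
  exact hv hx hy fun h => hxy (h ▸ rfl)

theorem IsRing.map (e : G ≃g H) {k : ℕ} (hG : IsRing G k) : IsRing H k := by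
  obtain ⟨hk, X, hX⟩ := hG
  refine ⟨hk, fun i => e '' X i, ?_, ?_, ?_, ?_⟩
  · exact fun i => (hX.nonempty i).image e
  · exact fun i j hij => (Set.disjoint_image_iff e.injective).mpr (hX.disjoint i j hij)
  · rw [← Set.image_iUnion, hX.cover, Set.image_univ, e.surjective.range_eq]
  · intro i
    obtain ⟨m, u, h1, h2, h3, h4, h5⟩ := hX.ordered i
    refine ⟨m, e ∘ u, e.injective.comp h1, ?_, ?_, ?_, ?_⟩
    · rw [Set.range_comp, h2]
    · rw [Function.comp_apply, ← image_closedNbhd]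
      exact Set.image_mono h3
    · intro a b hab
      rw [Function.comp_apply, Function.comp_apply, ← image_closedNbhd, ← image_closedNbhd]
      exact Set.image_mono (h4 a b hab)
    · rw [Function.comp_apply, ← image_closedNbhd, h5, Set.image_union, Set.image_union]

/-- An embedding restricts to an isomorphism from an induced subgraph onto its image. -/
noncomputable def induceImageIso (e : H ↪g G) (S : Set W) :
    G.induce (e '' S) ≃g H.induce S where
  toEquiv := (Equiv.Set.image e S e.injective).symm
  map_rel_iff' := by
    intro x y
    obtain ⟨x, rfl⟩ := (Equiv.Set.image e S e.injective).surjective x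
    obtain ⟨y, rfl⟩ := (Equiv.Set.image e S e.injective).surjective y
    simp

end Iso

theorem hereditary_ringClass (k : ℕ) : Hereditary (ringClass.{u} k) := by
  rintro G hG H ⟨e⟩ S hS
  have φ := induceImageIso e S
  rcases hG (e '' S) (hS.image e) with h | ⟨v, hv⟩
  · exact Or.inl (h.map φ)
  · exact Or.inr ⟨φ v, hv.map φ⟩

theorem containsComplete_ringClass (k : ℕ) : ContainsComplete (ringClass.{u} k) := by
  intro G hG S hS
  obtain ⟨v, hv⟩ := hS
  refine Or.inr ⟨⟨v, hv⟩, ?_⟩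
  intro x _ y _ hxy
  rw [hG]
  simpa [Subtype.ext_iff] using hxy

/-- The complete graph on `n` vertices. -/
def complete (n : ℕ) (hn : 1 ≤ n) : FinGraph.{u} where
  V := ULift (Fin n)
  graph := ⊤
  finite := inferInstance
  nonempty := ⟨⟨⟨0, hn⟩⟩⟩

theorem cliqueNum_complete (n : ℕ) (hn : 1 ≤ n) : (complete.{u} n hn).graph.cliqueNum = n := by
  change (⊤ : SimpleGraph (ULift (Fin n))).cliqueNum = n
  apply le_antisymm
  · obtain ⟨s, hs⟩ := (⊤ : SimpleGraph (ULift (Fin n))).exists_isNClique_cliqueNum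
    rw [← hs.card_eq]
    simpa using Finset.card_le_univ s
  · have : (⊤ : SimpleGraph (ULift (Fin n))).IsClique (Finset.univ : Finset (ULift (Fin n))) := by
      intro x _ y _ h
      exact h
    simpa using this.card_le_cliqueNum

theorem chromaticNumber_complete (n : ℕ) (hn : 1 ≤ n) :
    (complete.{u} n hn).graph.chromaticNumber = n := by
  change (⊤ : SimpleGraph (ULift (Fin n))).chromaticNumber = n
  rw [SimpleGraph.chromaticNumber_top]
  simp

/-! ### Blow-ups of cycles -/

/-- The graph in which distinct vertices are adjacent when their images in `ZMod k` are equal or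
consecutive: a blow-up of the cycle of length `k` with cliques as bags. -/
def blowup {V : Type*} {k : ℕ} (π : V → ZMod k) : SimpleGraph V where
  Adj x y := x ≠ y ∧ (π y = π x - 1 ∨ π y = π x ∨ π y = π x + 1)
  symm := ⟨by
    rintro x y ⟨h, h' | h' | h'⟩
    · exact ⟨h.symm, by right; right; rw [h']; ring⟩
    · exact ⟨h.symm, by right; left; rw [h']⟩
    · exact ⟨h.symm, by left; rw [h']; ring⟩⟩
  loopless := ⟨fun _ h => h.1 rfl⟩

section Blowup

variable {V : Type*} {k : ℕ} {π : V → ZMod k}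

theorem blowup_adj {x y : V} :
    (blowup π).Adj x y ↔ x ≠ y ∧ (π y = π x - 1 ∨ π y = π x ∨ π y = π x + 1) :=
  Iff.rfl

theorem induce_blowup (S : Set V) : (blowup π).induce S = blowup (fun x : S => π x) := by
  ext x y
  simp [blowup_adj, Subtype.ext_iff]

theorem closedNbhd_blowup (v : V) :
    closedNbhd (blowup π) v = π ⁻¹' {π v - 1} ∪ π ⁻¹' {π v} ∪ π ⁻¹' {π v + 1} := by
  ext w
  rw [mem_closedNbhd, blowup_adj]
  simp only [Set.mem_union, Set.mem_preimage, Set.mem_singleton_iff]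
  constructor
  · rintro (rfl | ⟨-, h⟩) <;> tauto
  · intro h
    rcases eq_or_ne w v with h' | h'
    · exact Or.inl h'
    · exact Or.inr ⟨h'.symm, by tauto⟩

/-- Vertices of one bag have the same closed neighbourhood, so any listing of the bag works. -/
theorem isRing_blowup [Finite V] (hk : 4 ≤ k) (hπ : Function.Surjective π) :
    IsRing (blowup π) k := by
  refine ⟨hk, fun i => π ⁻¹' {i}, fun i => hπ i, ?_, ?_, ?_⟩
  · intro i j hij
    rw [Set.disjoint_left]
    rintro x rfl h
    exact hij h
  · ext x
    simp
  · intro i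
    have hfin : Finite (π ⁻¹' {i}) := inferInstance
    have hne : Nonempty (π ⁻¹' {i}) := (hπ i).elim fun x hx => ⟨⟨x, hx⟩⟩
    obtain ⟨n, ⟨e⟩⟩ := Finite.exists_equiv_fin (π ⁻¹' {i})
    obtain ⟨m, rfl⟩ : ∃ m, n = m + 1 :=
      Nat.exists_eq_succ_of_ne_zero fun h => by subst h; exact (e hne.some).elim0
    have hmem : ∀ a, π (e.symm a) = i := fun a => (e.symm a).2
    refine ⟨m, fun a => e.symm a, Subtype.val_injective.comp e.symm.injective, ?_, ?_, ?_, ?_⟩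
    · rw [show (fun a => ((e.symm a : π ⁻¹' {i}) : V)) = Subtype.val ∘ e.symm from rfl,
        Set.range_comp, e.symm.surjective.range_eq, Set.image_univ, Subtype.range_val]
    · rw [closedNbhd_blowup, hmem]
      exact fun x hx => Or.inl (Or.inr hx)
    · intro a b _
      rw [closedNbhd_blowup, closedNbhd_blowup, hmem, hmem]
    · rw [closedNbhd_blowup, hmem]

/-- Some vertex has an empty bag just before its own, as otherwise stepping backwards would reach
every bag. Its neighbours lie in its own bag and the next, which together form a clique. -/
theorem exists_isSimplicial_blowup [NeZero k] [Nonempty V] (hπ : ¬ Function.Surjective π) :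
    ∃ v, IsSimplicial (blowup π) v := by
  obtain ⟨v, hv⟩ : ∃ v, ∀ w, π w ≠ π v - 1 := by
    by_contra! hall
    obtain ⟨v₀⟩ := ‹Nonempty V›
    have hdown : ∀ n : ℕ, ∃ w, π w = π v₀ - n := by
      intro n
      induction n with
      | zero => exact ⟨v₀, by simp⟩
      | succ n ih =>
        obtain ⟨w, hw⟩ := ih
        obtain ⟨w', hw'⟩ := hall w
        exact ⟨w', by rw [hw', hw]; push_cast; ring⟩
    refine hπ fun i => ?_
    obtain ⟨w, hw⟩ := hdown (π v₀ - i).val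
    exact ⟨w, by rw [hw, ZMod.natCast_zmod_val]; ring⟩
  refine ⟨v, ?_⟩
  rintro x ⟨-, hx⟩ y ⟨-, hy⟩ hxy
  have hx' := hx.resolve_left (hv x)
  have hy' := hy.resolve_left (hv y)
  refine ⟨hxy, ?_⟩
  rcases hx' with h | h <;> rcases hy' with h' | h' <;> rw [h, h'] <;> simp

theorem card_le_of_isClique_blowup [DecidableEq V] (hk : 4 ≤ k) {n : ℕ}
    (hn : ∀ (i : ZMod k) (s : Finset V), (∀ x ∈ s, π x = i ∨ π x = i + 1) → s.card ≤ n)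
    {s : Finset V} (hs : (blowup π).IsClique s) : s.card ≤ n := by
  have hne : ∀ j : ℕ, 1 ≤ j → j ≤ 3 → (j : ZMod k) ≠ 0 := by
    intro j h1 h2 h
    rw [ZMod.natCast_eq_zero_iff] at h
    have := Nat.le_of_dvd h1 h
    omega
  rcases s.eq_empty_or_nonempty with rfl | ⟨x, hx⟩
  · simp
  have hnb : ∀ a ∈ s, ∀ b ∈ s, π b = π a - 1 ∨ π b = π a ∨ π b = π a + 1 := by
    intro a ha b hb
    rcases eq_or_ne a b with rfl | h
    · exact Or.inr (Or.inl rfl)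
    · exact (hs ha hb h).2
  by_cases hprev : ∃ y ∈ s, π y = π x - 1
  · obtain ⟨y, hy, hyx⟩ := hprev
    refine hn (π x - 1) s fun z hz => ?_
    rcases hnb x hx z hz with h | h | h
    · exact Or.inl h
    · right; rw [h]; ring
    -- Here `y` and `z` lie two bags apart; adjacency would make `1`, `2` or `3` vanish modulo `k`,
    -- which `4 ≤ k` forbids.
    · exfalso
      have h1 := hne 1 (by norm_num) (by norm_num)
      have h2 := hne 2 (by norm_num) (by norm_num)
      have h3 := hne 3 (by norm_num) (by norm_num)
      push_cast at h1 h2 h3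
      rcases hnb y hy z hz with h' | h' | h' <;> rw [h, hyx] at h'
      · exact h3 (by linear_combination h')
      · exact h2 (by linear_combination h')
      · exact h1 (by linear_combination h')
  · refine hn (π x) s fun z hz => ?_
    rcases hnb x hx z hz with h | h | h
    · exact absurd ⟨z, hz, h⟩ hprev
    · exact Or.inl h
    · exact Or.inr h

/-- A stable set meets each bag at most once and no two consecutive bags, so its set of bags is
disjoint from its shift by one. -/
theorem two_mul_card_le_of_isIndepSet_blowup [NeZero k] {s : Finset V}
    (hs : ∀ x ∈ s, ∀ y ∈ s, ¬ (blowup π).Adj x y) (hk : 2 ≤ k) : 2 * s.card ≤ k := by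
  classical
  have hinj : Set.InjOn π s := by
    intro x hx y hy h
    by_contra hne
    exact hs x hx y hy ⟨hne, Or.inr (Or.inl h.symm)⟩
  have h1 : (s.image π).card = s.card := Finset.card_image_of_injOn hinj
  have h2 : ((s.image π).image (· + 1)).card = s.card := by
    rw [Finset.card_image_of_injective _ (add_left_injective 1), h1]
  have hdisj : Disjoint (s.image π) ((s.image π).image (· + 1)) := by
    rw [Finset.disjoint_left]
    intro i hi hi'
    simp only [Finset.mem_image, exists_exists_and_eq_and] at hi hi'
    obtain ⟨x, hx, rfl⟩ := hi
    obtain ⟨y, hy, h⟩ := hi'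
    have : Fact (1 < k) := ⟨hk⟩
    rcases eq_or_ne y x with rfl | hne
    · exact one_ne_zero (left_eq_add.mp h.symm)
    · exact hs y hy x hx ⟨hne, Or.inr (Or.inr h.symm)⟩
  have := Finset.card_le_univ (s.image π ∪ (s.image π).image (· + 1))
  rw [Finset.card_union_of_disjoint hdisj, h1, h2, ZMod.card] at this
  omega

theorem card_le_mul_of_colorable_blowup [Fintype V] {m c : ℕ} {π : V → ZMod (2 * m + 1)}
    (hm : 1 ≤ m) (hc : (blowup π).Colorable c) : Fintype.card V ≤ m * c := by
  classical
  obtain ⟨C⟩ := hc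
  have := Finset.card_le_mul_card_image_of_maps_to (f := C) (s := Finset.univ)
    (t := Finset.univ) (fun _ _ => Finset.mem_univ _) m (by
      intro b _
      have := two_mul_card_le_of_isIndepSet_blowup (π := π)
        (s := Finset.univ.filter fun a => C a = b) (by
          intro x hx y hy hxy
          simp only [Finset.mem_filter, Finset.mem_univ, true_and] at hx hy
          exact C.valid hxy (hx.trans hy.symm)) (by omega)
      omega)
  simpa using this

end Blowup

theorem blowup_mem_ringClass {k : ℕ} (hk : 4 ≤ k) (G : FinGraph.{u}) (π : G.V → ZMod k)
    (hG : G.graph = blowup π) : G ∈ ringClass.{u} k := by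
  intro S hS
  have : NeZero k := ⟨by omega⟩
  have : Nonempty S := hS.to_subtype
  rw [hG, induce_blowup]
  by_cases h : Function.Surjective fun x : S => π x
  · exact Or.inl (isRing_blowup hk h)
  · exact Or.inr (exists_isSimplicial_blowup h)

/-! ### The extremal blow-up -/

/-- The bag sizes of a blow-up of an odd cycle with clique number `n`: `⌊n / 2⌋` for bags of even
index and `⌈n / 2⌉` for bags of odd index. -/
def bagSize {k : ℕ} (n : ℕ) (i : ZMod k) : ℕ :=
  if i.val % 2 = 0 then n / 2 else n - n / 2

/-- The vertices of the blow-up with bag sizes `bagSize n`. -/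
abbrev BagVertex (k n : ℕ) : Type u :=
  ULift.{u} (Σ i : ZMod k, Fin (bagSize n i))

/-- The bag of a vertex. -/
def bagIndex {k n : ℕ} (x : BagVertex.{u} k n) : ZMod k :=
  x.down.1

/-- The blow-up of the cycle of length `k` with bag sizes `bagSize n`. -/
def balancedBlowup (k n : ℕ) [NeZero k] (hn : 2 ≤ n) : FinGraph.{u} where
  V := BagVertex.{u} k n
  graph := blowup bagIndex
  finite := inferInstance
  nonempty := ⟨⟨⟨0, ⟨0, by simp [bagSize]; omega⟩⟩⟩⟩

theorem card_bag {k n : ℕ} [NeZero k] (i : ZMod k) :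
    ((Finset.univ : Finset (BagVertex.{u} k n)).filter fun x => bagIndex x = i).card =
      bagSize n i := by
  rw [← Fintype.card_fin (bagSize n i), ← Fintype.card_subtype]
  refine Fintype.card_congr
    ⟨fun x => Fin.cast (congrArg (bagSize n) x.2) x.1.down.2, fun a => ⟨⟨⟨i, a⟩⟩, rfl⟩, ?_, ?_⟩
  · rintro ⟨⟨j, a⟩, rfl⟩
    rfl
  · intro a
    rfl

/-- Bags pair up into `m` consecutive pairs of total size `n`, leaving one bag of even index. -/
theorem card_bagVertex (m n : ℕ) :
    Fintype.card (BagVertex.{u} (2 * m + 1) n) = n * m + n / 2 := by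
  rw [Fintype.card_ulift, Fintype.card_sigma]
  simp only [Fintype.card_fin]
  have h : ∀ m : ℕ, ∑ j ∈ Finset.range (2 * m + 1),
      (if j % 2 = 0 then n / 2 else n - n / 2) = n * m + n / 2 := by
    intro m
    induction m with
    | zero => simp
    | succ m ih =>
      rw [show 2 * (m + 1) + 1 = 2 * m + 1 + 1 + 1 by ring, Finset.sum_range_succ,
        Finset.sum_range_succ, ih, if_neg (by omega), if_pos (by omega), mul_add]
      omega
  rw [← h m, ← Fin.sum_univ_eq_sum_range (fun j => if j % 2 = 0 then n / 2 else n - n / 2)]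
  rfl

/-- Equal parities meet only at the wrap-around of an odd cycle; both bags there have even index,
hence the smaller size. -/
theorem bagSize_add_bagSize_succ_le {k n : ℕ} [Fact (1 < k)] (i : ZMod k) :
    bagSize n i + bagSize n (i + 1) ≤ n := by
  have : NeZero k := ⟨by have := Fact.out (p := 1 < k); omega⟩
  have hi := ZMod.val_lt i
  unfold bagSize
  rw [ZMod.val_add, ZMod.val_one]
  rcases Nat.lt_or_ge (i.val + 1) k with h | h
  · rw [Nat.mod_eq_of_lt h]
    split_ifs <;> omega
  · rw [show i.val + 1 = k by omega, Nat.mod_self]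
    split_ifs <;> omega

theorem cliqueNum_balancedBlowup {k n : ℕ} [NeZero k] (hk : 4 ≤ k) (hn : 2 ≤ n) :
    (balancedBlowup.{u} k n hn).graph.cliqueNum = n := by
  classical
  have : Fact (1 < k) := ⟨by omega⟩
  have hone : ∀ i : ZMod k, i ≠ i + 1 := fun i h => one_ne_zero (left_eq_add.mp h)
  let B : ZMod k → Finset (BagVertex.{u} k n) := fun i =>
    Finset.univ.filter fun x => bagIndex x = i
  have hB : ∀ i, (B i ∪ B (i + 1)).card = bagSize n i + bagSize n (i + 1) := by
    intro i
    rw [Finset.card_union_of_disjoint, card_bag, card_bag]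
    rw [Finset.disjoint_left]
    intro x hx hy
    simp only [B, Finset.mem_filter, Finset.mem_univ, true_and] at hx hy
    exact hone i (hx.symm.trans hy)
  change (blowup (bagIndex (k := k) (n := n))).cliqueNum = n
  apply le_antisymm
  · obtain ⟨s, hs⟩ := (blowup (bagIndex.{u} (k := k) (n := n))).exists_isNClique_cliqueNum
    rw [← hs.card_eq]
    refine card_le_of_isClique_blowup hk (fun i t ht => ?_) hs.isClique
    refine le_trans (Finset.card_le_card ?_) ((hB i).trans_le (bagSize_add_bagSize_succ_le i))
    intro x hx
    simpa [B] using ht x hx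
  · have hc : (blowup (bagIndex.{u} (k := k) (n := n))).IsClique
        (B 0 ∪ B (0 + 1) : Finset (BagVertex.{u} k n)) := by
      intro x hx y hy hxy
      simp only [B, Finset.coe_union, Finset.coe_filter, Finset.mem_univ, true_and,
        Set.mem_union, Set.mem_ofPred_eq] at hx hy
      refine ⟨hxy, ?_⟩
      rcases hx with h | h <;> rcases hy with h' | h' <;> rw [h, h'] <;> simp
    refine le_trans ?_ hc.card_le_cliqueNum
    rw [hB]
    simp [bagSize, ZMod.val_one]
    omega

/-! ### The bounding function -/

theorem natCeil_div {a b : ℕ} (hb : 1 ≤ b) : ⌈(a : ℚ) / b⌉₊ = (a + b - 1) / b := by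
  apply eq_of_forall_ge_iff
  intro c
  rw [Nat.ceil_le, div_le_iff₀ (by positivity), ← Nat.lt_succ_iff, Nat.div_lt_iff_lt_mul hb,
    Nat.succ_mul]
  norm_cast
  omega

theorem ceil_bound {m n : ℕ} (hm : 1 ≤ m) :
    ⌈(2 : ℚ) * (⌊(n : ℚ) / 2⌋₊ : ℚ) / (((2 * m + 1 : ℕ) : ℚ) - 1)⌉₊ = (n / 2 + m - 1) / m := by
  have h : ⌊(n : ℚ) / 2⌋₊ = n / 2 := by exact_mod_cast Nat.floor_div_natCast (n : ℚ) 2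
  rw [← natCeil_div hm, h]
  congr 1
  push_cast
  field_simp
  ring

/-- Writing `n = 2 * m * q + r` with `r < 2 * m`, both sides equal `n + q` if `r ≤ 1` and `n + q +
1` otherwise. -/
theorem ringBound_eq {m : ℕ} (hm : 1 ≤ m) (n : ℕ) :
    ringBound (2 * m + 1) n = n + (n / 2 + m - 1) / m := by
  have h : ((2 * m + 1 : ℕ) : ℚ) * n / (((2 * m + 1 : ℕ) : ℚ) - 1) =
      (((2 * m + 1) * n : ℕ) : ℚ) / (2 * m : ℕ) := by
    push_cast
    congr 1
    ring
  obtain ⟨q, r, hr, rfl⟩ : ∃ q r, r < 2 * m ∧ n = 2 * m * q + r :=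
    ⟨n / (2 * m), n % (2 * m), Nat.mod_lt _ (by omega), (Nat.div_add_mod _ _).symm⟩
  have hmod : (2 * m * q + r) % (2 * m) = r := by
    rw [Nat.mul_add_mod, Nat.mod_eq_of_lt hr]
  have hhalf : (2 * m * q + r) / 2 = m * q + r / 2 := by
    rw [mul_assoc]; omega
  have e : (2 * m + 1) * (2 * m * q + r) = 2 * m * (2 * m * q + r + q) + r := by ring
  rw [ringBound, h, show 2 * m + 1 - 1 = 2 * m from rfl, hmod, hhalf, e]
  split_ifs with hcase
  · rw [Nat.floor_div_eq_div, Nat.mul_add_div (by omega), Nat.div_eq_of_lt hr,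
      show m * q + r / 2 + m - 1 = m * q + (m - 1) by omega, Nat.mul_add_div (by omega),
      Nat.div_eq_of_lt (by omega : m - 1 < m)]
    ring
  · push Not at hcase
    rw [natCeil_div (by omega), show 2 * m * (2 * m * q + r + q) + r + 2 * m - 1 =
      2 * m * (2 * m * q + r + q + 1) + (r - 1) by rw [mul_add _ _ 1]; omega,
      Nat.mul_add_div (by omega), Nat.div_eq_of_lt (by omega : r - 1 < 2 * m),
      show m * q + r / 2 + m - 1 = m * (q + 1) + (r / 2 - 1) by rw [mul_add]; omega,
      Nat.mul_add_div (by omega), Nat.div_eq_of_lt (by omega : r / 2 - 1 < m)]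
    ring

theorem le_mul_natCeil_div {a b : ℕ} (hb : 1 ≤ b) : a ≤ b * ((a + b - 1) / b) := by
  have h1 := Nat.div_add_mod (a + b - 1) b
  have h2 := Nat.mod_lt (a + b - 1) hb
  omega

/-! ### Optimality -/

theorem isOptimalChiBounding_of_even {k : ℕ} (hk : Even k) :
    IsOptimalChiBounding (ringClass.{u} k) (fun n => n) := by
  have hb : IsChiBounding (ringClass.{u} k) (fun n => n) :=
    isChiBounding_ringClass (fun n => le_rfl) fun V G n _ hG hn => hG.colorable_of_even hk hn
  refine ⟨⟨hereditary_ringClass k, _, hb⟩, containsComplete_ringClass k, hb, fun n hn => ?_⟩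
  exact ⟨complete n hn, containsComplete_ringClass k _ rfl, cliqueNum_complete n hn,
    chromaticNumber_complete n hn⟩

theorem isOptimalChiBounding_of_odd {m : ℕ} (hm : 2 ≤ m) :
    IsOptimalChiBounding (ringClass.{u} (2 * m + 1)) (ringBound (2 * m + 1)) := by
  have hb : IsChiBounding (ringClass.{u} (2 * m + 1)) (ringBound (2 * m + 1)) := by
    refine isChiBounding_ringClass (fun n => ?_) fun V G n hn1 hG hn => ?_
    · rw [ringBound_eq (by omega)]
      exact Nat.le_add_right _ _
    · rw [ringBound_eq (by omega)]
      exact hG.colorable_of_odd hn1 hn (le_mul_natCeil_div (by omega))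
  refine ⟨⟨hereditary_ringClass _, _, hb⟩, containsComplete_ringClass _, hb, fun n hn => ?_⟩
  -- For `n = 1` the bags of even index would be empty; the bound is then `1`, attained by a single
  -- vertex.
  rcases Nat.lt_or_ge n 2 with h | h
  · refine ⟨complete n hn, containsComplete_ringClass _ _ rfl, cliqueNum_complete n hn, ?_⟩
    rw [chromaticNumber_complete, ringBound_eq (by omega)]
    obtain rfl : n = 1 := by omega
    rw [Nat.div_eq_of_lt (by omega : 1 / 2 + m - 1 < m)]
  · have hmem : balancedBlowup.{u} (2 * m + 1) n h ∈ ringClass.{u} (2 * m + 1) :=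
      blowup_mem_ringClass (by omega) _ bagIndex rfl
    have hω := cliqueNum_balancedBlowup.{u} (k := 2 * m + 1) (by omega) h
    refine ⟨_, hmem, hω, le_antisymm ?_ ?_⟩
    · have := hb _ hmem
      rwa [hω] at this
    · rw [SimpleGraph.le_chromaticNumber_iff_colorable]
      intro c hc
      have hcard : Fintype.card (BagVertex.{u} (2 * m + 1) n) ≤ m * c :=
        card_le_mul_of_colorable_blowup (by omega) hc
      rw [card_bagVertex] at hcard
      rw [ringBound_eq (by omega)]
      -- This allows writing `c = n + d`; the vertex count then reduces to `n / 2 ≤ m * d`.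
      have hnc : n ≤ c := by
        by_contra hlt
        have := Nat.mul_le_mul_left m (show c + 1 ≤ n by omega)
        have e : n * m = m * n := mul_comm _ _
        rw [mul_add] at this
        omega
      obtain ⟨d, rfl⟩ := Nat.exists_eq_add_of_le hnc
      have hd : n / 2 ≤ m * d := by
        rw [mul_add, mul_comm] at hcard
        omega
      have : (n / 2 + m - 1) / m ≤ d := by
        rw [← Nat.lt_succ_iff, Nat.div_lt_iff_lt_mul (by omega), Nat.succ_mul, mul_comm]
        omega
      omega

end FinGraph

theorem theorem6p7 (k : ℕ) (hk : 4 ≤ k) :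
    FinGraph.ChiBounded (FinGraph.ringClass.{u} k) ∧
    (Even k → FinGraph.IsOptimalChiBounding (FinGraph.ringClass.{u} k) (fun n => n)) ∧
    (Odd k → FinGraph.IsOptimalChiBounding (FinGraph.ringClass.{u} k) (FinGraph.ringBound k) ∧
      ∀ n : ℕ, 1 ≤ n → FinGraph.ringBound k n =
        n + ⌈(2 : ℚ) * (⌊(n : ℚ) / 2⌋₊ : ℚ) / ((k : ℚ) - 1)⌉₊) := by
  refine ⟨?_, FinGraph.isOptimalChiBounding_of_even, ?_⟩
  · rcases Nat.even_or_odd k with h | ⟨m, rfl⟩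
    · exact (FinGraph.isOptimalChiBounding_of_even h).chiBounded
    · exact (FinGraph.isOptimalChiBounding_of_odd (by omega)).chiBounded
  · rintro ⟨m, rfl⟩
    refine ⟨FinGraph.isOptimalChiBounding_of_odd (by omega), fun n _ => ?_⟩
    rw [FinGraph.ringBound_eq (by omega), FinGraph.ceil_bound (by omega)]
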